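/- Theorem. For $n\ge 0$ let $u_n(321)$ be the number of permutations $p=p_1p_2\cdots p_n$ of $\{1,\dots,n\}$ such that (i) $p$ avoids the pattern $321$, i.e. there are no indices $i<j<k$ with $p_i>p_j>p_k$, and (ii) $p$ has a unique longest increasing subsequence (ULIS), i.e. $p$ has an increasing subsequence (a set of positions along which the entries of $p$ increase) that is strictly longer than every other increasing subsequence of $p$; by convention the empty permutation has a ULIS, so $u_0(321)=1$. Then the ordinary generating function $$u_{321}(z)=\sum_{n\ge 0}u_n(321)\,z^n$$ is not rational: there are no polynomials $P,Q\in\mathbb{C}[z]$ with $Q\neq 0$ and $Q(z)\,u_{321}(z)=P(z)$ as formal power series. -/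

import Mathlib

namespace ULIS

/-- The permutation `p` of length `n` contains the pattern `q` of length `k`: there are positions
`i 0 < i 1 < ⋯ < i (k-1)` at which the entries of `p` are in the same relative order as the
entries of `q`. A permutation `p` of length `n` is written in one-line notation as
`p 0, p 1, …, p (n-1)`, with positions and entries numbered from zero. -/
def Contains {k n : ℕ} (q : Equiv.Perm (Fin k)) (p : Equiv.Perm (Fin n)) : Prop :=
  ∃ i : Fin k ↪o Fin n, ∀ r s : Fin k, p (i r) < p (i s) ↔ q r < q s

/-- The permutation `p` avoids the pattern `q`. -/
def Avoids {k n : ℕ} (q : Equiv.Perm (Fin k)) (p : Equiv.Perm (Fin n)) : Prop :=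
  ¬ Contains q p

/-- The set `S` of positions carries an increasing subsequence of `p`. -/
def IsIncreasingSubseq {n : ℕ} (p : Equiv.Perm (Fin n)) (S : Finset (Fin n)) : Prop :=
  ∀ i ∈ S, ∀ j ∈ S, i < j → p i < p j

/-- The permutation `p` has a unique longest increasing subsequence: some increasing subsequence
is longer than all other increasing subsequences. -/
def HasULIS {n : ℕ} (p : Equiv.Perm (Fin n)) : Prop :=
  ∃ S : Finset (Fin n), IsIncreasingSubseq p S ∧
    ∀ T : Finset (Fin n), IsIncreasingSubseq p T → T ≠ S → T.card < S.card

/-- The number of permutations of length `n` that avoid `q` and have a unique longest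
increasing subsequence. -/
noncomputable def count {k : ℕ} (q : Equiv.Perm (Fin k)) (n : ℕ) : ℕ :=
  Nat.card {p : Equiv.Perm (Fin n) // Avoids q p ∧ HasULIS p}

/-- The ordinary generating function of the numbers `count q n`, `n ≥ 0`. -/
noncomputable def genFun {k : ℕ} (q : Equiv.Perm (Fin k)) : PowerSeries ℂ :=
  PowerSeries.mk fun n => (count q n : ℂ)

/-- The pattern 321, that is, the reversal of three letters. -/
def pattern321 : Equiv.Perm (Fin 3) := Fin.revPerm

/-- A formal power series is rational if it is a quotient `P / Q` of two polynomials. -/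
def IsRational (f : PowerSeries ℂ) : Prop :=
  ∃ P Q : Polynomial ℂ, Q ≠ 0 ∧ (Q : PowerSeries ℂ) * f = (P : PowerSeries ℂ)

end ULIS

/-! If a rational power series has coefficients `a n` with `a n / 4 ^ n → 0`, it has no pole in the
closed disc of radius 1/4, so `a n / 4 ^ n` decays geometrically
(`geometricDecay_of_mul_eq_polynomial`). The counting sequence tends to zero on this scale, but only
polynomially fast.

Upper bound: a 321-avoider is a union of two increasing sequences and is determined by the positions
and values of its left-to-right maxima, so there are at most `centralBinom n = o(4 ^ n)` of them.

Lower bound: two ballot sets, prescribing the positions and (reversed) values of an increasing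
sequence of length `m + 1`, yield a 321-avoider of length `2 * m + 1` in which that sequence is the
ULIS (`sq_card_isBallot_le_count`). Hence the count is at least `catalan m ^ 2`, of order `16 ^ m /
m ^ 3`. -/

open Filter Topology

namespace ULIS

/-! ### Rational series: null coefficients decay geometrically -/

/-- The sequence `b` decays at least geometrically. -/
def GeometricDecay (b : ℕ → ℂ) : Prop :=
  ∃ C ρ : ℝ, 0 < ρ ∧ ρ < 1 ∧ ∀ n, ‖b n‖ ≤ C * ρ ^ n

theorem geometricDecay_of_eventually_zero {b : ℕ → ℂ} {N : ℕ} (h : ∀ n, N ≤ n → b n = 0) :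
    GeometricDecay b := by
  refine ⟨∑ i ∈ Finset.range N, ‖b i‖ * 2 ^ i, 1 / 2, by norm_num, by norm_num, fun n => ?_⟩
  have h0 : ∀ i ∈ Finset.range N, 0 ≤ ‖b i‖ * (2 : ℝ) ^ i := fun i _ => by positivity
  rcases le_or_gt N n with hn | hn
  · rw [h n hn, norm_zero]
    exact mul_nonneg (Finset.sum_nonneg h0) (by positivity)
  · have := Finset.single_le_sum h0 (Finset.mem_range.2 hn)
    calc ‖b n‖ = ‖b n‖ * 2 ^ n * (1 / 2) ^ n := by
          rw [mul_assoc, ← mul_pow]; norm_num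
      _ ≤ _ := by gcongr

/-- For `‖s‖ ≤ 1`, iterating towards infinity leaves only a geometric tail of `g`. For `‖s‖ > 1`,
solving for `b (n + 1)` gives a contraction. -/
theorem geometricDecay_of_recurrence {b g : ℕ → ℂ} {s : ℂ} (hb : Tendsto b atTop (𝓝 0))
    (hg : GeometricDecay g) (h : ∀ n, b n = s * b (n + 1) + g n) : GeometricDecay b := by
  obtain ⟨C, ρ, hρ0, hρ1, hC⟩ := hg
  have hC0 : 0 ≤ C := by simpa using (norm_nonneg _).trans (hC 0)
  have hρ' : 0 < 1 - ρ := by linarith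
  rcases le_or_gt ‖s‖ 1 with hs | hs
  · refine ⟨C / (1 - ρ), ρ, hρ0, hρ1, fun n => ?_⟩
    have key : ∀ k, ∀ n, ‖b n‖ ≤ ‖b (n + k)‖ + C / (1 - ρ) * ρ ^ n := by
      intro k
      induction k with
      | zero => intro n; simp only [add_zero, le_add_iff_nonneg_right]; positivity
      | succ k ih =>
        intro n
        have h1 : ‖b n‖ ≤ ‖b (n + 1)‖ + C * ρ ^ n := by
          rw [h n]
          refine (norm_add_le _ _).trans (add_le_add ?_ (hC n))
          rw [norm_mul]
          exact mul_le_of_le_one_left (norm_nonneg _) hs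
        have h2 := ih (n + 1)
        have h3 : C / (1 - ρ) * ρ ^ (n + 1) + C * ρ ^ n = C / (1 - ρ) * ρ ^ n := by
          field_simp; ring
        rw [show n + (k + 1) = n + 1 + k by ring]
        linarith
    have hlim : Tendsto (fun k => ‖b (n + k)‖ + C / (1 - ρ) * ρ ^ n) atTop
        (𝓝 (0 + C / (1 - ρ) * ρ ^ n)) := by
      refine Tendsto.add_const _ ?_
      have := (hb.norm).comp (tendsto_add_atTop_nat n)
      simpa [Function.comp_def, add_comm] using this
    rw [zero_add] at hlim
    exact ge_of_tendsto' hlim fun k => key k n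
  · have hs0 : 0 < ‖s‖ := by linarith
    have hlt : max ρ (1 / ‖s‖) < 1 := max_lt hρ1 ((div_lt_one hs0).2 hs)
    -- Taking `σ` strictly above both rates avoids a resonance factor `n` when they coincide.
    obtain ⟨σ, hσ, hσ1⟩ := exists_between hlt
    obtain ⟨h1, h2⟩ := max_lt_iff.1 hσ
    have hσ0 : 0 < σ := hρ0.trans h1
    have h3 : 0 < σ * ‖s‖ - 1 := by
      rw [div_lt_iff₀ hs0] at h2; linarith
    refine ⟨max ‖b 0‖ (C / (σ * ‖s‖ - 1)), σ, hσ0, hσ1, fun n => ?_⟩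
    set K := max ‖b 0‖ (C / (σ * ‖s‖ - 1))
    have hK : C ≤ K * (σ * ‖s‖ - 1) := (div_le_iff₀ h3).1 (le_max_right _ _)
    induction n with
    | zero => rw [pow_zero, mul_one]; exact le_max_left _ _
    | succ n ih =>
      have h4 : ‖s‖ * ‖b (n + 1)‖ ≤ ‖b n‖ + C * ρ ^ n := by
        rw [← norm_mul, show s * b (n + 1) = b n - g n by rw [h n]; ring]
        exact (norm_sub_le _ _).trans (add_le_add le_rfl (hC n))
      have h5 : C * ρ ^ n ≤ K * (σ * ‖s‖ - 1) * σ ^ n := by gcongr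
      refine le_of_mul_le_mul_left ?_ hs0
      calc ‖s‖ * ‖b (n + 1)‖ ≤ K * σ ^ n + K * (σ * ‖s‖ - 1) * σ ^ n := by linarith
        _ = ‖s‖ * (K * σ ^ (n + 1)) := by ring

/-- Induction on the degree of `Q`: a root `r` is moved into the series `(X - r) * f`, whose
rescaled coefficients drive a recurrence for those of `f` with `s = c * r`. -/
theorem geometricDecay_of_mul_eq_polynomial {c : ℂ} (hc : c ≠ 0) (d : ℕ) :
    ∀ (P Q : Polynomial ℂ) (f : PowerSeries ℂ), Q.natDegree = d → Q ≠ 0 →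
      (Q : PowerSeries ℂ) * f = (P : PowerSeries ℂ) →
      Tendsto (fun n => PowerSeries.coeff n f / c ^ n) atTop (𝓝 0) →
      GeometricDecay fun n => PowerSeries.coeff n f / c ^ n := by
  induction d with
  | zero =>
    intro P Q f hd hQ hf _
    obtain ⟨a, rfl⟩ := Polynomial.natDegree_eq_zero.1 hd
    have ha : a ≠ 0 := by simpa using hQ
    refine geometricDecay_of_eventually_zero (N := P.natDegree + 1) fun n hn => ?_
    have h1 := congrArg (PowerSeries.coeff n) hf
    rw [Polynomial.coe_C, PowerSeries.coeff_C_mul, Polynomial.coeff_coe,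
      Polynomial.coeff_eq_zero_of_natDegree_lt (by omega)] at h1
    rw [(mul_eq_zero.1 h1).resolve_left ha, zero_div]
  | succ d ih =>
    intro P Q f hd hQ hf hlim
    obtain ⟨r, hr⟩ := IsAlgClosed.exists_root Q (by
      rw [Polynomial.degree_eq_natDegree hQ, hd]; exact_mod_cast Nat.succ_ne_zero d)
    obtain ⟨Q₁, rfl⟩ := Polynomial.dvd_iff_isRoot.2 hr
    have hQ₁ : Q₁ ≠ 0 := right_ne_zero_of_mul hQ
    rw [Polynomial.natDegree_mul (Polynomial.X_sub_C_ne_zero r) hQ₁,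
      Polynomial.natDegree_X_sub_C] at hd
    set g : PowerSeries ℂ := (PowerSeries.X - PowerSeries.C r) * f with hgdef
    have hg : (Q₁ : PowerSeries ℂ) * g = P := by
      rw [← hf, hgdef]; push_cast; ring
    have hgs : ∀ n, PowerSeries.coeff (n + 1) g =
        PowerSeries.coeff n f - r * PowerSeries.coeff (n + 1) f := by
      intro n
      rw [hgdef, sub_mul, map_sub, PowerSeries.coeff_succ_X_mul, PowerSeries.coeff_C_mul]
    have hgs' : ∀ n, PowerSeries.coeff (n + 1) g / c ^ (n + 1) =
        c⁻¹ * (PowerSeries.coeff n f / c ^ n) -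
          r * (PowerSeries.coeff (n + 1) f / c ^ (n + 1)) := by
      intro n
      rw [hgs]; field_simp; ring
    have hglim : Tendsto (fun n => PowerSeries.coeff n g / c ^ n) atTop (𝓝 0) := by
      rw [← tendsto_add_atTop_iff_nat 1]
      simp only [hgs']
      simpa using (hlim.const_mul c⁻¹).sub
        (((tendsto_add_atTop_iff_nat 1).2 hlim).const_mul r)
    obtain ⟨C, ρ, hρ0, hρ1, hC⟩ := ih P Q₁ g (by omega) hQ₁ hg hglim
    refine geometricDecay_of_recurrence (s := c * r)
      (g := fun n => c * (PowerSeries.coeff (n + 1) g / c ^ (n + 1))) hlim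
      ⟨‖c‖ * (C * ρ), ρ, hρ0, hρ1, fun n => ?_⟩ fun n => ?_
    · rw [norm_mul, mul_assoc, mul_assoc]
      refine mul_le_mul_of_nonneg_left ((hC (n + 1)).trans_eq ?_) (norm_nonneg _)
      ring
    · rw [hgs']; field_simp; ring

/-! ### Upper bound by central binomial coefficients -/

theorem tendsto_centralBinom_div_four_pow :
    Tendsto (fun n => (n.centralBinom : ℝ) / 4 ^ n) atTop (𝓝 0) := by
  -- The weight `2 * n + 1` closes the induction since `(2n+1)(2n+3) ≤ (2n+2)^2`.
  have hsq : ∀ n : ℕ, ((n.centralBinom : ℝ) / 4 ^ n) ^ 2 * (2 * n + 1) ≤ 1 := by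
    intro n
    induction n with
    | zero => simp
    | succ n ih =>
      have h : ((n : ℝ) + 1) * ((n + 1).centralBinom : ℝ) = 2 * (2 * n + 1) * n.centralBinom := by
        exact_mod_cast Nat.succ_mul_centralBinom_succ n
      have h1 : ((n + 1).centralBinom : ℝ) / 4 ^ (n + 1) =
          (2 * n + 1) / (2 * (n + 1)) * (n.centralBinom / 4 ^ n) := by
        field_simp; linear_combination (2 * 4 ^ n) * h
      have h2 : ((2 * n + 1 : ℝ) / (2 * (n + 1))) ^ 2 * (2 * n + 3) ≤ 2 * n + 1 := by
        rw [div_pow, div_mul_eq_mul_div, div_le_iff₀ (by positivity)]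
        have : (0 : ℝ) ≤ n := n.cast_nonneg
        nlinarith
      rw [h1]; push_cast
      calc _ = ((2 * n + 1 : ℝ) / (2 * (n + 1))) ^ 2 * (2 * n + 3) *
              ((n.centralBinom : ℝ) / 4 ^ n) ^ 2 := by ring
        _ ≤ (2 * n + 1) * ((n.centralBinom : ℝ) / 4 ^ n) ^ 2 := by gcongr
        _ ≤ 1 := by linarith
  have hlim : Tendsto (fun n : ℕ => (1 : ℝ) / (n + 1)) atTop (𝓝 0) :=
    tendsto_one_div_add_atTop_nhds_zero_nat
  have h2 : Tendsto (fun n => ((n.centralBinom : ℝ) / 4 ^ n) ^ 2) atTop (𝓝 0) := by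
    refine squeeze_zero (fun n => sq_nonneg _) (fun n => ?_) hlim
    rw [le_div_iff₀ (by positivity)]
    refine le_trans ?_ (hsq n)
    gcongr
    linarith [(n.cast_nonneg : (0 : ℝ) ≤ n)]
  have h3 := h2.sqrt
  simp only [Real.sqrt_zero] at h3
  refine h3.congr fun n => Real.sqrt_sq (by positivity)

theorem contains_pattern321_iff {n : ℕ} (p : Equiv.Perm (Fin n)) :
    Contains pattern321 p ↔ ∃ i j k : Fin n, i < j ∧ j < k ∧ p k < p j ∧ p j < p i := by
  constructor
  · rintro ⟨i, hi⟩
    refine ⟨i 0, i 1, i 2, i.strictMono (by decide), i.strictMono (by decide),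
      (hi 2 1).2 (by decide), (hi 1 0).2 (by decide)⟩
  · rintro ⟨i, j, k, hij, hjk, h1, h2⟩
    have hmono : StrictMono ![i, j, k] := by
      rw [Fin.strictMono_iff_lt_succ]
      intro r
      fin_cases r
      · exact hij
      · exact hjk
    refine ⟨OrderEmbedding.ofStrictMono _ hmono, fun r s => ?_⟩
    have h3 := h1.trans h2
    fin_cases r <;> fin_cases s <;>
      simp [pattern321, h1, h2, h3, h1.le, h2.le, h3.le]

/-- The positions of the left-to-right maxima of `p`. -/
def leftToRightMaxima {n : ℕ} (p : Equiv.Perm (Fin n)) : Finset (Fin n) :=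
  {i | ∀ j < i, p j < p i}

theorem isIncreasingSubseq_leftToRightMaxima {n : ℕ} (p : Equiv.Perm (Fin n)) :
    IsIncreasingSubseq p (leftToRightMaxima p) := by
  intro i _ j hj hij
  exact (Finset.mem_filter.1 hj).2 i hij

theorem isIncreasingSubseq_compl_leftToRightMaxima {n : ℕ} {p : Equiv.Perm (Fin n)}
    (hp : Avoids pattern321 p) : IsIncreasingSubseq p (leftToRightMaxima p)ᶜ := by
  intro i hi j _ hij
  by_contra hlt
  have hji : p j < p i := lt_of_le_of_ne (not_lt.1 hlt) fun h => hij.ne' (p.injective h)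
  simp only [leftToRightMaxima, Finset.compl_filter, Finset.mem_filter, Finset.mem_univ,
    true_and, not_forall, not_lt] at hi
  obtain ⟨k, hk, hki⟩ := hi
  have hik : p i < p k := lt_of_le_of_ne hki fun h => hk.ne' (p.injective h)
  exact hp ((contains_pattern321_iff p).2 ⟨k, i, j, hk, hij, hji, hik⟩)

theorem eqOn_of_isIncreasingSubseq {n : ℕ} {p q : Equiv.Perm (Fin n)} {S : Finset (Fin n)}
    (hp : IsIncreasingSubseq p S) (hq : IsIncreasingSubseq q S) (h : S.image p = S.image q) :
    ∀ i ∈ S, p i = q i := by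
  have key : ∀ r : Equiv.Perm (Fin n), IsIncreasingSubseq r S → S.image r = S.image q →
      (fun x => r (S.orderEmbOfFin rfl x)) = (S.image q).orderEmbOfFin
        (Finset.card_image_of_injective S q.injective) := by
    intro r hr h
    refine Finset.orderEmbOfFin_unique _ (fun x => ?_) fun x y hxy => ?_
    · rw [← h]
      exact Finset.mem_image_of_mem _ (Finset.orderEmbOfFin_mem _ _ _)
    · exact hr _ (Finset.orderEmbOfFin_mem _ _ _) _ (Finset.orderEmbOfFin_mem _ _ _)
        ((S.orderEmbOfFin rfl).strictMono hxy)
  intro i hi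
  have hmem : i ∈ Set.range (S.orderEmbOfFin rfl) := by
    rw [Finset.range_orderEmbOfFin]; exact hi
  obtain ⟨x, rfl⟩ := hmem
  exact congrFun ((key p hp h).trans (key q hq rfl).symm) x

theorem image_compl_perm {n : ℕ} (p : Equiv.Perm (Fin n)) (S : Finset (Fin n)) :
    Sᶜ.image p = (S.image p)ᶜ := by
  rw [Finset.compl_eq_univ_sdiff, Finset.image_sdiff _ _ p.injective,
    Finset.image_univ_of_surjective p.surjective, Finset.compl_eq_univ_sdiff]

/-- Complementing the value set makes the code an `n`-subset of a `2n`-set. -/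
theorem count_pattern321_le_centralBinom (n : ℕ) : count pattern321 n ≤ n.centralBinom := by
  let F : {p : Equiv.Perm (Fin n) // Avoids pattern321 p ∧ HasULIS p} →
      (Finset.univ.powersetCard n : Finset (Finset (Fin n ⊕ Fin n))) := fun p =>
    ⟨(leftToRightMaxima p.1).disjSum ((leftToRightMaxima p.1).image p.1)ᶜ, by
      rw [Finset.mem_powersetCard]
      refine ⟨Finset.subset_univ _, ?_⟩
      rw [Finset.card_disjSum, Finset.card_compl, Finset.card_image_of_injective _ p.1.injective,
        Fintype.card_fin]
      have := Finset.card_le_univ (leftToRightMaxima p.1)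
      rw [Fintype.card_fin] at this
      omega⟩
  have hF : Function.Injective F := by
    rintro ⟨p, hp, hp'⟩ ⟨q, hq, hq'⟩ h
    have h1 := Finset.disjSum_inj.1 (Subtype.ext_iff.1 h)
    simp only [compl_inj_iff] at h1
    obtain ⟨hA, hB⟩ := h1
    have hpi := isIncreasingSubseq_compl_leftToRightMaxima hp
    rw [hA] at hB hpi
    have hp1 := isIncreasingSubseq_leftToRightMaxima p
    rw [hA] at hp1
    refine Subtype.ext (Equiv.ext fun i => ?_)
    by_cases hi : i ∈ leftToRightMaxima q
    · exact eqOn_of_isIncreasingSubseq hp1 (isIncreasingSubseq_leftToRightMaxima q) hB i hi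
    · refine eqOn_of_isIncreasingSubseq hpi (isIncreasingSubseq_compl_leftToRightMaxima hq) ?_ i
        (Finset.mem_compl.2 hi)
      rw [image_compl_perm, image_compl_perm, hB]
  have := Nat.card_le_card_of_injective F hF
  rw [Nat.card_eq_fintype_card (α := ↥(Finset.univ.powersetCard n)), Fintype.card_coe,
    Finset.card_powersetCard, Finset.card_univ, Fintype.card_sum, Fintype.card_fin] at this
  rwa [Nat.centralBinom_eq_two_mul_choose, two_mul]

/-- `A` has `m + 1` of the `2 * m + 1` positions, and each element of its complement is preceded
by at least two more elements of `A` than of the complement. -/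
structure IsBallot (m : ℕ) (A : Finset (Fin (2 * m + 1))) : Prop where
  card_eq : A.card = m + 1
  card_compl_eq : Aᶜ.card = m
  lt (r : Fin m) : A.orderEmbOfFin card_eq r.succ < Aᶜ.orderEmbOfFin card_compl_eq r

/-! ### Permutations from pairs of ballot sets -/

variable {m : ℕ} {A A' : Finset (Fin (2 * m + 1))}

/-- The enumeration of `A` and of its complement, both increasing. -/
noncomputable def IsBallot.enum (hA : IsBallot m A) : Fin (m + 1) ⊕ Fin m ≃ Fin (2 * m + 1) :=
  finSumEquivOfFinset hA.card_eq hA.card_compl_eq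

theorem IsBallot.enum_inl_lt (hA : IsBallot m A) {i j : Fin (m + 1)} :
    hA.enum (.inl i) < hA.enum (.inl j) ↔ i < j := by
  simp [IsBallot.enum]

theorem IsBallot.enum_inr_lt (hA : IsBallot m A) {i j : Fin m} :
    hA.enum (.inr i) < hA.enum (.inr j) ↔ i < j := by
  simp [IsBallot.enum]

theorem IsBallot.enum_inl_succ_lt (hA : IsBallot m A) (r : Fin m) :
    hA.enum (.inl r.succ) < hA.enum (.inr r) := by
  simpa [IsBallot.enum] using hA.lt r

theorem IsBallot.enum_inl_mem (hA : IsBallot m A) (i : Fin (m + 1)) : hA.enum (.inl i) ∈ A := by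
  simp [IsBallot.enum]

theorem IsBallot.enum_inr_notMem (hA : IsBallot m A) (i : Fin m) : hA.enum (.inr i) ∉ A := by
  rw [← Finset.mem_compl, IsBallot.enum, finSumEquivOfFinset_inr]
  exact Finset.orderEmbOfFin_mem _ _ _

/-- The permutation that maps `A` increasingly onto the reversal of `A'`, and the complement of
`A` increasingly onto the reversal of the complement of `A'`. -/
noncomputable def ballotPerm (hA : IsBallot m A) (hA' : IsBallot m A') :
    Equiv.Perm (Fin (2 * m + 1)) :=
  hA.enum.symm.trans
    ((Equiv.sumCongr Fin.revPerm Fin.revPerm).trans (hA'.enum.trans Fin.revPerm))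

variable (hA : IsBallot m A) (hA' : IsBallot m A')

theorem ballotPerm_enum_inl (i : Fin (m + 1)) :
    ballotPerm hA hA' (hA.enum (.inl i)) = (hA'.enum (.inl i.rev)).rev := by
  simp [ballotPerm]

theorem ballotPerm_enum_inr (i : Fin m) :
    ballotPerm hA hA' (hA.enum (.inr i)) = (hA'.enum (.inr i.rev)).rev := by
  simp [ballotPerm]

theorem isIncreasingSubseq_ballotPerm : IsIncreasingSubseq (ballotPerm hA hA') A := by
  intro x hx y hy hxy
  obtain ⟨i | i, rfl⟩ := hA.enum.surjective x
  · obtain ⟨j | j, rfl⟩ := hA.enum.surjective y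
    · rw [ballotPerm_enum_inl, ballotPerm_enum_inl, Fin.rev_lt_rev, hA'.enum_inl_lt,
        Fin.rev_lt_rev]
      exact hA.enum_inl_lt.1 hxy
    · exact absurd hy (hA.enum_inr_notMem j)
  · exact absurd hx (hA.enum_inr_notMem i)

theorem isIncreasingSubseq_ballotPerm_compl : IsIncreasingSubseq (ballotPerm hA hA') Aᶜ := by
  intro x hx y hy hxy
  rw [Finset.mem_compl] at hx hy
  obtain ⟨i | i, rfl⟩ := hA.enum.surjective x
  · exact absurd (hA.enum_inl_mem i) hx
  · obtain ⟨j | j, rfl⟩ := hA.enum.surjective y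
    · exact absurd (hA.enum_inl_mem j) hy
    · rw [ballotPerm_enum_inr, ballotPerm_enum_inr, Fin.rev_lt_rev, hA'.enum_inr_lt,
        Fin.rev_lt_rev]
      exact hA.enum_inr_lt.1 hxy

/-- Reversal turns the `succ` in the ballot condition of `A'` into `castSucc`. -/
theorem ballotPerm_enum_inr_lt (r : Fin m) :
    ballotPerm hA hA' (hA.enum (.inr r)) < ballotPerm hA hA' (hA.enum (.inl r.castSucc)) := by
  rw [ballotPerm_enum_inl, ballotPerm_enum_inr, Fin.rev_lt_rev, Fin.rev_castSucc]
  exact hA'.enum_inl_succ_lt _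

/-- Every inversion pairs `A` with its complement, impossible for three mutually inverted positions.
-/
theorem avoids_ballotPerm : Avoids pattern321 (ballotPerm hA hA') := by
  rintro ⟨i, hi⟩
  have h01 : i 0 < i 1 := i.strictMono (by decide)
  have h12 : i 1 < i 2 := i.strictMono (by decide)
  have d10 := (hi 1 0).2 (by decide)
  have d21 := (hi 2 1).2 (by decide)
  have key : ∀ x y, x < y → ballotPerm hA hA' y < ballotPerm hA hA' x → (x ∈ A ↔ y ∉ A) := by
    intro x y hxy hlt
    constructor
    · exact fun hx hy => hlt.asymm (isIncreasingSubseq_ballotPerm hA hA' x hx y hy hxy)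
    · intro hy
      by_contra hx
      exact hlt.asymm (isIncreasingSubseq_ballotPerm_compl hA hA' x (Finset.mem_compl.2 hx) y
        (Finset.mem_compl.2 hy) hxy)
  have k1 := key _ _ h01 d10
  have k2 := key _ _ h12 d21
  have k3 := key _ _ (h01.trans h12) (d21.trans d10)
  tauto

/-- The complement element of index `r` is inverted with the elements `r.castSucc` and `r.succ` of
`A`, so using `k > 0` complement elements costs at least `k + 1` elements of `A`. -/
theorem card_lt_of_isIncreasingSubseq_ballotPerm {T : Finset (Fin (2 * m + 1))}
    (hT : IsIncreasingSubseq (ballotPerm hA hA') T) (hne : T ≠ A) : T.card < A.card := by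
  classical
  by_cases hsub : T ⊆ A
  · exact Finset.card_lt_card (hsub.ssubset_of_ne hne)
  let R : Finset (Fin m) := {r | hA.enum (.inr r) ∈ T}
  let L : Finset (Fin (m + 1)) := {i | hA.enum (.inl i) ∈ T}
  have hcard : T.card = L.card + R.card := by
    rw [← Finset.card_disjSum, ← Finset.card_map hA.enum.toEmbedding]
    congr 1
    ext x
    obtain ⟨i | i, rfl⟩ := hA.enum.surjective x <;> simp [L, R]
  have hR : R.Nonempty := by
    obtain ⟨x, hx, hxA⟩ := Finset.not_subset.1 hsub
    obtain ⟨i | i, rfl⟩ := hA.enum.surjective x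
    · exact absurd (hA.enum_inl_mem i) hxA
    · exact ⟨i, by simpa [R] using hx⟩
  have hno : ∀ r ∈ R, r.castSucc ∉ L ∧ r.succ ∉ L := by
    intro r hr
    have hr' : hA.enum (.inr r) ∈ T := by simpa [R] using hr
    have hlt := hA.enum_inl_succ_lt r
    have hcs := Fin.castSucc_lt_succ (i := r)
    have hval := ballotPerm_enum_inr_lt hA hA' r
    constructor
    · intro h
      have h' : hA.enum (.inl r.castSucc) ∈ T := by simpa [L] using h
      exact hval.asymm (hT _ h' _ hr' ((hA.enum_inl_lt.2 hcs).trans hlt))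
    · intro h
      have h' : hA.enum (.inl r.succ) ∈ T := by simpa [L] using h
      refine (hval.trans ?_).asymm (hT _ h' _ hr' hlt)
      exact isIncreasingSubseq_ballotPerm hA hA' _ (hA.enum_inl_mem _) _ (hA.enum_inl_mem _)
        (hA.enum_inl_lt.2 hcs)
  -- The `castSucc` of the minimum lies below all the successors and supplies the extra `+ 1`.
  let N : Finset (Fin (m + 1)) := insert (R.min' hR).castSucc (R.image Fin.succ)
  have hN : N.card = R.card + 1 := by
    rw [Finset.card_insert_of_notMem, Finset.card_image_of_injective _ (Fin.succ_injective m)]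
    intro h
    obtain ⟨r, hr, h⟩ := Finset.mem_image.1 h
    have h1 : (R.min' hR) ≤ r := R.min'_le r hr
    have h2 := congrArg Fin.val h
    rw [Fin.le_def] at h1
    simp only [Fin.val_succ, Fin.val_castSucc] at h2
    omega
  have hdisj : Disjoint L N := by
    rw [Finset.disjoint_right]
    intro x hx
    rcases Finset.mem_insert.1 hx with rfl | hx
    · exact (hno _ (R.min'_mem hR)).1
    · obtain ⟨r, hr, rfl⟩ := Finset.mem_image.1 hx
      exact (hno r hr).2
  have := Finset.card_le_univ (L ∪ N)
  rw [Finset.card_union_of_disjoint hdisj, hN, Fintype.card_fin] at this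
  rw [hcard, hA.card_eq]
  omega

theorem hasULIS_ballotPerm : HasULIS (ballotPerm hA hA') :=
  ⟨A, isIncreasingSubseq_ballotPerm hA hA',
    fun _ hT hne => card_lt_of_isIncreasingSubseq_ballotPerm hA hA' hT hne⟩

theorem image_rev_ballotPerm : (A.image fun x => (ballotPerm hA hA' x).rev) = A' := by
  refine Finset.eq_of_subset_of_card_le (fun y hy => ?_) ?_
  · obtain ⟨x, hx, rfl⟩ := Finset.mem_image.1 hy
    obtain ⟨i | i, rfl⟩ := hA.enum.surjective x
    · rw [ballotPerm_enum_inl, Fin.rev_rev]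
      exact hA'.enum_inl_mem _
    · exact absurd hx (hA.enum_inr_notMem i)
  · rw [Finset.card_image_of_injective (f := fun x => (ballotPerm hA hA' x).rev) _
      (Fin.rev_injective.comp (ballotPerm hA hA').injective), hA.card_eq, hA'.card_eq]

theorem ballotPerm_inj {B B' : Finset (Fin (2 * m + 1))} {hA : IsBallot m A}
    {hA' : IsBallot m A'} {hB : IsBallot m B} {hB' : IsBallot m B'}
    (h : ballotPerm hA hA' = ballotPerm hB hB') : A = B ∧ A' = B' := by
  have hAB : A = B := by
    by_contra hne
    have h1 := card_lt_of_isIncreasingSubseq_ballotPerm hB hB'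
      (h ▸ isIncreasingSubseq_ballotPerm hA hA') hne
    rw [hA.card_eq, hB.card_eq] at h1
    exact lt_irrefl _ h1
  subst hAB
  refine ⟨rfl, ?_⟩
  rw [← image_rev_ballotPerm hA hA', h, image_rev_ballotPerm hB hB']

theorem sq_card_isBallot_le_count (m : ℕ) :
    Nat.card {A // IsBallot m A} ^ 2 ≤ count pattern321 (2 * m + 1) := by
  rw [sq, ← Nat.card_prod]
  refine Nat.card_le_card_of_injective
    (fun x => ⟨ballotPerm x.1.2 x.2.2, avoids_ballotPerm _ _, hasULIS_ballotPerm _ _⟩) ?_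
  rintro ⟨⟨A, hA⟩, ⟨A', hA'⟩⟩ ⟨⟨B, hB⟩, ⟨B', hB'⟩⟩ h
  obtain ⟨h1, h2⟩ := ballotPerm_inj (Subtype.ext_iff.1 h)
  simp only at h1 h2
  subst h1 h2
  rfl

/-! ### Catalan many ballot sets from Dyck words -/

/-- The positions of the up steps of a Dyck word that is prefixed with one more up step. -/
def upSteps (m : ℕ) (w : DyckWord) : Finset (Fin (2 * m + 1)) :=
  {i | (DyckStep.U :: w.toList)[(i : ℕ)]? = some DyckStep.U}

theorem card_filter_getElem?_eq_some {α : Type*} [DecidableEq α] (l : List α) (a : α) (t : ℕ) :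
    ((Finset.range t).filter fun i => l[i]? = some a).card = (l.take t).count a := by
  induction t with
  | zero => simp
  | succ t ih =>
    rw [Finset.range_add_one, Finset.filter_insert, List.take_add_one, List.count_append, ← ih]
    cases h : l[t]? with
    | none => simp
    | some b =>
      by_cases hb : b = a
      · subst hb; simp
      · simp [hb]

theorem card_filter_fin_eq_card_filter_range {N t : ℕ} (ht : t ≤ N) (P : ℕ → Prop)
    [DecidablePred P] :
    ((Finset.univ : Finset (Fin N)).filter fun i : Fin _ => (i : ℕ) < t ∧ P i).card =
      ((Finset.range t).filter P).card := by
  rw [← Finset.card_map Fin.valEmbedding]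
  congr 1
  ext x
  simp only [Finset.mem_map, Finset.mem_filter, Finset.mem_univ, true_and, Finset.mem_range,
    Fin.valEmbedding_apply]
  constructor
  · rintro ⟨i, h, rfl⟩; exact h
  · rintro ⟨h1, h2⟩; exact ⟨⟨x, h1.trans_le ht⟩, ⟨h1, h2⟩, rfl⟩

theorem getElem?_cons_eq_some_D_iff {w : DyckWord} (hw : w.semilength = m)
    (i : Fin (2 * m + 1)) :
    (DyckStep.U :: w.toList)[(i : ℕ)]? = some DyckStep.D ↔ i ∉ upSteps m w := by
  have hl : (DyckStep.U :: w.toList).length = 2 * m + 1 := by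
    rw [List.length_cons, ← w.two_mul_semilength_eq_length, hw]
  have hi : (i : ℕ) < (DyckStep.U :: w.toList).length := i.2.trans_eq hl.symm
  simp only [upSteps, Finset.mem_filter, Finset.mem_univ, true_and,
    List.getElem?_eq_getElem hi, Option.some.injEq]
  rcases DyckStep.dichotomy (DyckStep.U :: w.toList)[(i : ℕ)] with h | h <;> simp [h]

theorem card_upSteps_lt {w : DyckWord} {t : ℕ} (ht : t ≤ 2 * m + 1) :
    ((upSteps m w).filter fun i : Fin _ => (i : ℕ) < t).card =
      ((DyckStep.U :: w.toList).take t).count DyckStep.U := by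
  rw [← card_filter_getElem?_eq_some, ← card_filter_fin_eq_card_filter_range ht, upSteps,
    Finset.filter_filter]
  simp only [and_comm]

theorem card_compl_upSteps_lt {w : DyckWord} (hw : w.semilength = m)
    {t : ℕ} (ht : t ≤ 2 * m + 1) :
    ((upSteps m w)ᶜ.filter fun i : Fin _ => (i : ℕ) < t).card =
      ((DyckStep.U :: w.toList).take t).count DyckStep.D := by
  rw [← card_filter_getElem?_eq_some, ← card_filter_fin_eq_card_filter_range ht]
  congr 1
  ext i
  simp [getElem?_cons_eq_some_D_iff hw, and_comm]

/-- If the condition failed at `r`, the prefix ending at that down step would contain at least `r +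
1` down steps and, discounting the added initial one, at most `r` up steps. -/
theorem isBallot_upSteps {w : DyckWord} (hw : w.semilength = m) :
    IsBallot m (upSteps m w) := by
  have hl : (DyckStep.U :: w.toList).length = 2 * m + 1 := by
    rw [List.length_cons, ← w.two_mul_semilength_eq_length, hw]
  have hall : ∀ S : Finset (Fin (2 * m + 1)), (S.filter fun i : Fin _ => (i : ℕ) < 2 * m + 1) = S :=
    fun S => Finset.filter_true_of_mem fun i _ => i.2
  have h1 : (upSteps m w).card = m + 1 := by
    have := card_upSteps_lt (w := w) (le_refl (2 * m + 1))
    rwa [hall, List.take_of_length_le hl.le, List.count_cons_self, ← DyckWord.semilength,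
      hw] at this
  have h2 : (upSteps m w)ᶜ.card = m := by
    rw [Finset.card_compl, h1, Fintype.card_fin]; omega
  refine ⟨h1, h2, fun r => ?_⟩
  by_contra hlt
  set c := (upSteps m w)ᶜ.orderEmbOfFin h2 r with hc
  rw [not_lt] at hlt
  have hcmem : c ∈ (upSteps m w)ᶜ := Finset.orderEmbOfFin_mem _ _ _
  have hlt' : c < (upSteps m w).orderEmbOfFin h1 r.succ := by
    refine lt_of_le_of_ne hlt fun h => ?_
    rw [h] at hcmem
    exact Finset.mem_compl.1 hcmem (Finset.orderEmbOfFin_mem _ _ _)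
  have hU : ((upSteps m w).filter fun i : Fin _ => (i : ℕ) < c + 1).card ≤ r + 1 := by
    have : ((upSteps m w).filter fun i : Fin _ => (i : ℕ) < c + 1) ⊆
        (Finset.Iio r.succ).image ((upSteps m w).orderEmbOfFin h1) := by
      intro x hx
      rw [Finset.mem_filter] at hx
      have hx1 : x ∈ Set.range ((upSteps m w).orderEmbOfFin h1) := by
        rw [Finset.range_orderEmbOfFin]; exact hx.1
      obtain ⟨y, rfl⟩ := hx1
      refine Finset.mem_image_of_mem _ (Finset.mem_Iio.2 ?_)
      rw [← ((upSteps m w).orderEmbOfFin h1).lt_iff_lt]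
      exact lt_of_le_of_lt (Fin.le_def.2 (Nat.lt_succ_iff.1 hx.2)) hlt'
    refine (Finset.card_le_card this).trans (Finset.card_image_le.trans ?_)
    rw [Fin.card_Iio, Fin.val_succ]
  have hD : r + 1 ≤ ((upSteps m w)ᶜ.filter fun i : Fin _ => (i : ℕ) < c + 1).card := by
    have : (Finset.Iic r).image ((upSteps m w)ᶜ.orderEmbOfFin h2) ⊆
        ((upSteps m w)ᶜ.filter fun i : Fin _ => (i : ℕ) < c + 1) := by
      intro x hx
      obtain ⟨y, hy, rfl⟩ := Finset.mem_image.1 hx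
      refine Finset.mem_filter.2 ⟨Finset.orderEmbOfFin_mem _ _ _, Nat.lt_succ_iff.2 ?_⟩
      exact Fin.le_def.1 (((upSteps m w)ᶜ.orderEmbOfFin h2).monotone (Finset.mem_Iic.1 hy))
    refine le_trans ?_ (Finset.card_le_card this)
    rw [Finset.card_image_of_injective _ (RelEmbedding.injective _), Fin.card_Iic]
  rw [card_upSteps_lt (by omega), List.take_succ_cons, List.count_cons_self] at hU
  rw [card_compl_upSteps_lt hw (by omega), List.take_succ_cons,
    List.count_cons_of_ne (by decide)] at hD
  have := w.count_D_le_count_U c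
  omega

theorem upSteps_injective {v w : DyckWord} (hv : v.semilength = m) (hw : w.semilength = m)
    (h : upSteps m v = upSteps m w) : v = w := by
  refine DyckWord.ext ((List.cons_inj_right DyckStep.U).1 (List.ext_getElem? fun i => ?_))
  rcases lt_or_ge i (2 * m + 1) with hi | hi
  · by_cases hmem : (⟨i, hi⟩ : Fin (2 * m + 1)) ∈ upSteps m w
    · have hmem' := h ▸ hmem
      exact (Finset.mem_filter.1 hmem').2.trans (Finset.mem_filter.1 hmem).2.symm
    · exact ((getElem?_cons_eq_some_D_iff hv ⟨i, hi⟩).2 (h ▸ hmem)).trans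
        ((getElem?_cons_eq_some_D_iff hw ⟨i, hi⟩).2 hmem).symm
  · have hv' := v.two_mul_semilength_eq_length
    have hw' := w.two_mul_semilength_eq_length
    rw [List.getElem?_eq_none (by rw [List.length_cons]; omega),
      List.getElem?_eq_none (by rw [List.length_cons]; omega)]

theorem catalan_le_card_isBallot (m : ℕ) : catalan m ≤ Nat.card {A // IsBallot m A} := by
  rw [← DyckWord.card_dyckWord_semilength_eq_catalan, ← Nat.card_eq_fintype_card]
  refine Nat.card_le_card_of_injective (fun w => ⟨upSteps m w.1, isBallot_upSteps w.2⟩) ?_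
  intro v w h
  exact Subtype.ext (upSteps_injective v.2 w.2 (Subtype.ext_iff.1 h))

/-! ### Comparison of growth rates -/

theorem four_pow_le_mul_catalan (m : ℕ) (hm : 0 < m) : 4 ^ m ≤ 2 * m * (m + 1) * catalan m := by
  have h1 := Nat.four_pow_le_two_mul_self_mul_centralBinom m hm
  have h2 : (m + 1) * catalan m = m.centralBinom := by
    rw [catalan_eq_centralBinom_div, Nat.mul_div_cancel' (Nat.succ_dvd_centralBinom m)]
  rwa [mul_assoc, h2]

theorem tendsto_genFun_coeff :
    Tendsto (fun n => PowerSeries.coeff n (genFun pattern321) / (4 : ℂ) ^ n) atTop (𝓝 0) := by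
  refine squeeze_zero_norm (fun n => ?_) tendsto_centralBinom_div_four_pow
  rw [genFun, PowerSeries.coeff_mk, norm_div, norm_pow, Complex.norm_natCast, Complex.norm_ofNat]
  gcongr
  exact_mod_cast count_pattern321_le_centralBinom n

theorem not_geometricDecay_genFun_coeff :
    ¬ GeometricDecay fun n => PowerSeries.coeff n (genFun pattern321) / (4 : ℂ) ^ n := by
  rintro ⟨C, ρ, hρ0, hρ1, h⟩
  -- At `n = 2 * m + 1` the scaled count is at least `1 / (16 * (m + 1) ^ 4)`; `ρ ^ n` is written
  -- `(ρ ^ 2) ^ (m + 1) / ρ` to match the shifted limit below.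
  have hle : ∀ m : ℕ, 0 < m → 1 ≤ 16 * C * (((m : ℝ) + 1) ^ 4 * (ρ ^ 2) ^ (m + 1)) / ρ := by
    intro m hm
    have h1 := h (2 * m + 1)
    beta_reduce at h1
    rw [genFun, PowerSeries.coeff_mk, norm_div, norm_pow, Complex.norm_natCast,
      Complex.norm_ofNat, div_le_iff₀ (by positivity)] at h1
    have h2 : (catalan m : ℝ) ^ 2 ≤ count pattern321 (2 * m + 1) := by
      exact_mod_cast (Nat.pow_le_pow_left (catalan_le_card_isBallot m) 2).trans
        (sq_card_isBallot_le_count m)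
    have h3 : (4 : ℝ) ^ m ≤ 2 * (m + 1) ^ 2 * catalan m := by
      have : (4 : ℝ) ^ m ≤ 2 * m * (m + 1) * catalan m := by
        exact_mod_cast four_pow_le_mul_catalan m hm
      refine this.trans ?_
      rw [sq, ← mul_assoc]
      gcongr
      linarith
    have h4 : ((4 : ℝ) ^ m) ^ 2 ≤ 4 * (m + 1) ^ 4 * (C * ρ ^ (2 * m + 1) * 4 ^ (2 * m + 1)) :=
      calc ((4 : ℝ) ^ m) ^ 2 ≤ (2 * (m + 1) ^ 2 * catalan m) ^ 2 := by gcongr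
        _ = 4 * (m + 1) ^ 4 * (catalan m : ℝ) ^ 2 := by ring
        _ ≤ _ := by gcongr; exact h2.trans h1
    refine le_of_mul_le_mul_left ?_ (by positivity : (0 : ℝ) < (4 ^ m) ^ 2)
    rw [mul_one]
    refine h4.trans_eq ?_
    field_simp
    ring
  have hlim : Tendsto (fun m : ℕ => 16 * C * (((m : ℝ) + 1) ^ 4 * (ρ ^ 2) ^ (m + 1)) / ρ)
      atTop (𝓝 (16 * C * 0 / ρ)) := by
    refine Tendsto.div_const (Tendsto.const_mul _ ?_) _
    have := (tendsto_add_atTop_iff_nat 1).2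
      (tendsto_pow_const_mul_const_pow_of_lt_one 4 (sq_nonneg ρ) (by nlinarith : ρ ^ 2 < 1))
    simpa using this
  have := ge_of_tendsto hlim ((eventually_gt_atTop 0).mono hle)
  norm_num at this

end ULIS

theorem mainTheorem2 : ¬ ULIS.IsRational (ULIS.genFun ULIS.pattern321) := by
  rintro ⟨P, Q, hQ, h⟩
  exact ULIS.not_geometricDecay_genFun_coeff <|
    ULIS.geometricDecay_of_mul_eq_polynomial (c := (4 : ℂ)) (by norm_num) _ P Q _ rfl hQ h
      ULIS.tendsto_genFun_coeff
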